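/- For $n\ge 0$ let $R_n$ be the number of acyclic digraphs on $n$ labelled vertices, and let $O_n$ be the number of those all of whose vertices have even out-degree. (By the classification of small covers, these are the numbers of all, respectively of orientable, small covers over the $n$-cube up to Davis–Januszkiewicz equivalence; this identification is background and not part of the statement.) Let $F(x)=\sum_{n\ge 0} \dfrac{x^n}{n!\,2^{\binom n2}}$, an entire function. Then $F$ has a real zero $\alpha\approx -1.488$, which is simple and satisfies $|\alpha|<|z|$ for every other complex zero $z$ of $F$. Moreover $F(\alpha/2)\neq 0$, and with $$C=-\frac{1}{\alpha F(\alpha/2)},\qquad K=-\frac{1-F(2\alpha)}{\alpha F(\alpha/2)}$$ we have, as $n\to\infty$, $$R_n\sim C\,2^{\binom n2}\,n!\left(-\frac1\alpha\right)^n,\qquad O_n\sim K\,2^{\binom n2}\,n!\left(-\frac1{2\alpha}\right)^n,\qquad \frac{O_n}{R_n}\sim\frac{K}{C\,2^n},$$ where $K/C\approx 1.262$. Here "$\approx$" means agreement to three decimal places, that is, an error of less than $0.0005$. -/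

import Mathlib

open Filter Asymptotics

/-- A digraph is acyclic if it has no closed directed walk of positive length
(`Relation.TransGen G.Adj u v` says that there is a directed walk of length at least one from
`u` to `v`). In particular an acyclic digraph has no loops, and `Digraph` has no multiple edges,
so an acyclic `Digraph` is a simple digraph without directed cycles. -/
def Digraph.IsAcyclicDigraph {V : Type*} (G : Digraph V) : Prop :=
  ∀ v : V, ¬ Relation.TransGen G.Adj v v

/-- The out-degree of `v`: the number of edges with initial vertex `v`. -/
noncomputable def Digraph.outDeg {V : Type*} (G : Digraph V) (v : V) : ℕ :=
  {w : V | G.Adj v w}.ncard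

/-- `R_n`: the number of acyclic digraphs on `n` labelled vertices. -/
noncomputable def acyclicCount (n : ℕ) : ℕ :=
  {G : Digraph (Fin n) | G.IsAcyclicDigraph}.ncard

/-- `O_n`: the number of acyclic digraphs on `n` labelled vertices all of whose vertices have
even out-degree. -/
noncomputable def evenAcyclicCount (n : ℕ) : ℕ :=
  {G : Digraph (Fin n) | G.IsAcyclicDigraph ∧ ∀ v, Even (G.outDeg v)}.ncard

/-- The power series `F(x) = ∑ xⁿ / (n! 2^(n choose 2))`, for real or complex `x`. -/
noncomputable def chromaticF {𝕜 : Type*} [RCLike 𝕜] (x : 𝕜) : 𝕜 :=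
  ∑' n : ℕ, x ^ n / ((n.factorial : 𝕜) * 2 ^ n.choose 2)

/-- The series defining `F` converges absolutely everywhere, so `tsum` is its genuine sum. -/
theorem summable_norm_chromaticF {𝕜 : Type*} [RCLike 𝕜] (x : 𝕜) :
    Summable fun n : ℕ => ‖x ^ n / ((n.factorial : 𝕜) * 2 ^ n.choose 2)‖ := by
  refine Summable.of_nonneg_of_le (fun _ => norm_nonneg _) (fun n => ?_)
    (Real.summable_pow_div_factorial ‖x‖)
  rw [norm_div, norm_pow, norm_mul, norm_pow, RCLike.norm_natCast, RCLike.norm_ofNat]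
  have h1 : (1 : ℝ) ≤ 2 ^ n.choose 2 := one_le_pow₀ (by norm_num)
  have h2 : (0 : ℝ) < n.factorial := by exact_mod_cast n.factorial_pos
  exact div_le_div_of_nonneg_left (by positivity) h2 (le_mul_of_one_le_right h2.le h1)

/-!
Removing the sources of an acyclic digraph leaves an acyclic digraph, and every nonempty finite
acyclic digraph has a source. Inclusion–exclusion over sets of sources (`sum_acyclicWithCount`)
therefore gives a recursion for the number of acyclic digraphs with restricted out-degrees, in which
the `k` sources choose their out-neighbourhoods independently among the other `n - k` vertices. For
the weights `1 / (n! 2^(n choose 2))` it says that the generating functions of `Rₙ` and `Oₙ` are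
`R(x) = 1 / F(-x)` and `O(2x) = 1 + (1 - F(-2x)) R(x)` (`mk_chromaticTerm_mul_acyclicCount`,
`mk_chromaticTerm_mul_evenAcyclicCount`).

The asymptotics come from the zero `α` of `F` closest to the origin, and no contour integration is
needed. Let `tₙ` be the terms of the series `F(α) = 0` and `sₙ` its partial sums, so that
`F(αw) = (1 - w) S(w)` with `S(w) = ∑ sₙ wⁿ`. A partial sum is minus the tail that follows it, hence
the `sₙ` decay superexponentially, and numerically `∑_{n ≥ 1} |sₙ| < 1 = s₀`
(`tsum_norm_chromaticPartialSum_succ_lt`). This one inequality does everything: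

* `S` has no zero on the closed unit disc, so `F` has no zero with `|z| ≤ |α|` other than `α`;
* `1 / S` has absolutely summable coefficients, so those of `1 / F(αw) = (1 / S(w)) · 1 / (1 - w)`,
  which are the partial sums of the former, converge to `1 / S(1)`
  (`tendsto_of_mk_mul_mk_eq_one`).

Summation by parts and the functional equation `F'(x) = F(x / 2)` evaluate
`S(1) = -α F'(α) = -α F(α / 2)`, which is nonzero; hence `α` is simple and the limit is `C`. The
factor `1 - F(2αw)` has absolutely summable coefficients and multiplies the limit by its value at
`w = 1`, which gives `K = C (1 - F(2α))`.
-/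

/-! ### Counting acyclic digraphs by their sources -/

/-- The acyclic digraphs on `V` all of whose out-degrees satisfy `P`. -/
def acyclicWith (P : ℕ → Prop) (V : Type*) : Set (Digraph V) :=
  {G | G.IsAcyclicDigraph ∧ ∀ v, P (G.outDeg v)}

/-- The number of acyclic digraphs on `n` labelled vertices all of whose out-degrees satisfy `P`. -/
noncomputable def acyclicWithCount (P : ℕ → Prop) (n : ℕ) : ℕ :=
  Nat.card (acyclicWith P (Fin n))

/-- The number of subsets of an `m`-element set whose cardinality satisfies `P`. -/
noncomputable def subsetCount (P : ℕ → Prop) (m : ℕ) : ℕ :=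
  Nat.card {T : Set (Fin m) // P T.ncard}

theorem natCard_subset_eq_subsetCount (P : ℕ → Prop) {W : Type*} [Fintype W] :
    Nat.card {T : Set W // P T.ncard} = subsetCount P (Fintype.card W) := by
  refine Nat.card_congr ((Equiv.Set.congr (Fintype.equivFin W)).subtypeEquiv fun T => ?_)
  simp [Equiv.Set.congr, Set.ncard_image_of_injective _ (Fintype.equivFin W).injective]

theorem Digraph.outDeg_of_equiv {V W : Type*} (e : V ≃ W) {G : Digraph V} {H : Digraph W}
    (h : ∀ a b, G.Adj a b ↔ H.Adj (e a) (e b)) (v : V) : G.outDeg v = H.outDeg (e v) := by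
  unfold Digraph.outDeg
  rw [← Set.ncard_image_of_injective _ e.injective]
  congr 1
  ext w
  obtain ⟨u, rfl⟩ := e.surjective w
  simp [h]

theorem Digraph.IsAcyclicDigraph.of_hom {V W : Type*} {G : Digraph V} {H : Digraph W}
    (hH : H.IsAcyclicDigraph) (f : V → W) (h : ∀ a b, G.Adj a b → H.Adj (f a) (f b)) :
    G.IsAcyclicDigraph :=
  fun v hv => hH (f v) (hv.lift f h)

theorem natCard_acyclicWith (P : ℕ → Prop) {V : Type*} [Fintype V] :
    Nat.card (acyclicWith P V) = acyclicWithCount P (Fintype.card V) := by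
  set e := Fintype.equivFin V
  let E : Digraph V ≃ Digraph (Fin (Fintype.card V)) :=
    { toFun := fun G => ⟨fun a b => G.Adj (e.symm a) (e.symm b)⟩
      invFun := fun G => ⟨fun a b => G.Adj (e a) (e b)⟩
      left_inv := fun G => by ext; simp
      right_inv := fun G => by ext; simp }
  refine Nat.card_congr (E.subtypeEquiv fun G => ?_)
  have h : ∀ a b, G.Adj a b ↔ (E G).Adj (e a) (e b) := fun a b => by simp [E]
  have h' : ∀ a b, (E G).Adj a b → G.Adj (e.symm a) (e.symm b) := fun a b hab => hab
  refine and_congr ⟨fun hG => hG.of_hom _ h', fun hG => hG.of_hom _ fun a b => (h a b).1⟩ ?_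
  rw [← e.forall_congr_right (q := fun v => P ((E G).outDeg v))]
  simp only [Digraph.outDeg_of_equiv e h]

/-- The set of sources of `G`, the vertices without incoming edges. -/
noncomputable def Digraph.sources {V : Type*} [Fintype V] (G : Digraph V) : Finset V := by
  classical exact Finset.univ.filter fun v => ∀ u, ¬ G.Adj u v

theorem Digraph.mem_sources {V : Type*} [Fintype V] {G : Digraph V} {v : V} :
    v ∈ G.sources ↔ ∀ u, ¬ G.Adj u v := by
  simp [Digraph.sources]

theorem Digraph.IsAcyclicDigraph.sources_nonempty {V : Type*} [Fintype V] [Nonempty V]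
    {G : Digraph V} (hG : G.IsAcyclicDigraph) : G.sources.Nonempty := by
  have : Std.Irrefl (Relation.TransGen G.Adj) := ⟨hG⟩
  obtain ⟨v, -, hv⟩ := (Finite.wellFounded_of_trans_of_irrefl (Relation.TransGen G.Adj)).has_min
    Set.univ Set.univ_nonempty
  exact ⟨v, Digraph.mem_sources.2 fun u hu => hv u trivial (.single hu)⟩

/-- The digraph on `V` whose restriction to the complement of `S` is `H`, in which `s ∈ S` has
out-neighbourhood `f s`, and in which no edge enters `S`. -/
def Digraph.addSources {V : Type*} (S : Set V) (H : Digraph ↥Sᶜ) (f : S → Set ↥Sᶜ) :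
    Digraph V where
  Adj a b := ∃ hb : b ∈ Sᶜ, (∃ ha : a ∈ S, ⟨b, hb⟩ ∈ f ⟨a, ha⟩) ∨
    ∃ ha : a ∈ Sᶜ, H.Adj ⟨a, ha⟩ ⟨b, hb⟩

/-- Digraphs in which every vertex of `S` is a source: such a digraph is given by its restriction
to the complement of `S` and the out-neighbourhoods of the vertices of `S`. -/
def Digraph.sourcesEquiv {V : Type*} (S : Set V) :
    {G : Digraph V // ∀ v ∈ S, ∀ u, ¬ G.Adj u v} ≃ Digraph ↥Sᶜ × (S → Set ↥Sᶜ) where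
  toFun G := (⟨fun a b => G.1.Adj a b⟩, fun s => {t | G.1.Adj s t})
  invFun p := ⟨Digraph.addSources S p.1 p.2, fun _ hv _ h => h.1 hv⟩
  left_inv := by
    rintro ⟨G, hG⟩
    ext a b
    simp only [Digraph.addSources, Set.mem_ofPred_eq]
    constructor
    · rintro ⟨hb, ⟨ha, h⟩ | ⟨ha, h⟩⟩ <;> exact h
    · intro h
      refine ⟨fun hb => hG b hb a h, ?_⟩
      by_cases ha : a ∈ S
      · exact .inl ⟨ha, h⟩
      · exact .inr ⟨ha, h⟩
  right_inv := by
    rintro ⟨H, f⟩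
    refine Prod.ext ?_ ?_
    · ext a b
      have ha := a.2
      have hb := b.2
      rw [Set.mem_compl_iff] at ha hb
      simp [Digraph.addSources, ha, hb]
    · ext s t
      have ht := t.2
      rw [Set.mem_compl_iff] at ht
      simp [Digraph.addSources, ht]

theorem Digraph.isAcyclicDigraph_iff_restrict {V : Type*} {S : Set V} {G : Digraph V}
    (hG : ∀ v ∈ S, ∀ u, ¬ G.Adj u v) :
    G.IsAcyclicDigraph ↔
      (⟨fun a b => G.Adj a b⟩ : Digraph ↥Sᶜ).IsAcyclicDigraph := by
  refine ⟨fun h => h.of_hom Subtype.val fun a b hab => hab, fun h v hv => ?_⟩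
  -- a walk that starts outside `S` never enters `S`
  have key : ∀ a b, Relation.TransGen G.Adj a b → ∀ ha : a ∈ Sᶜ, ∃ hb : b ∈ Sᶜ,
      Relation.TransGen (fun x y : ↥Sᶜ => G.Adj x y) ⟨a, ha⟩ ⟨b, hb⟩ := by
    intro a b hab ha
    induction hab with
    | single e => exact ⟨fun hb => hG _ hb _ e, .single e⟩
    | tail _ e ih =>
      obtain ⟨hb, ih⟩ := ih
      exact ⟨fun hc => hG _ hc _ e, ih.tail e⟩
  have hvS : v ∈ Sᶜ := fun hvS => by
    obtain ⟨u, -, hu⟩ := Relation.TransGen.tail'_iff.1 hv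
    exact hG v hvS u hu
  obtain ⟨_, hv'⟩ := key v v hv hvS
  exact h _ hv'

theorem Digraph.outDeg_eq_ncard_restrict {V : Type*} {S : Set V} {G : Digraph V}
    (hG : ∀ v ∈ S, ∀ u, ¬ G.Adj u v) (v : V) :
    G.outDeg v = {t : ↥Sᶜ | G.Adj v t}.ncard := by
  rw [Digraph.outDeg, ← Set.ncard_image_of_injective _ Subtype.val_injective]
  congr 1
  ext w
  simp only [Set.mem_ofPred_eq, Set.mem_image, Subtype.exists, exists_and_left, exists_prop,
    exists_eq_right_right, iff_self_and]
  exact fun h hw => hG w hw v h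

/-- The number of acyclic digraphs with prescribed sources: the out-neighbourhoods of the vertices
of `S` are chosen freely in the complement, on which the digraph restricts to any admissible one. -/
theorem natCard_acyclicWith_sources (P : ℕ → Prop) {V : Type*} [Fintype V] (S : Finset V) :
    Nat.card {G : Digraph V // G ∈ acyclicWith P V ∧ S ⊆ G.sources} =
      subsetCount P (Fintype.card V - S.card) ^ S.card *
        acyclicWithCount P (Fintype.card V - S.card) := by
  classical
  have hcard : Fintype.card ↥(S : Set V)ᶜ = Fintype.card V - S.card := by
    rw [Fintype.card_compl_set]
    simp
  have e1 : {G : Digraph V // G ∈ acyclicWith P V ∧ S ⊆ G.sources} ≃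
      {G : {G : Digraph V // ∀ v ∈ (S : Set V), ∀ u, ¬ G.Adj u v} // G.1 ∈ acyclicWith P V} :=
    (Equiv.subtypeEquivRight fun G => by
      rw [and_comm]
      refine and_congr_left fun _ => ?_
      simp only [Finset.subset_iff, Digraph.mem_sources, Finset.mem_coe]).trans
      (Equiv.subtypeSubtypeEquivSubtypeInter _ _).symm
  have e2 : {G : {G : Digraph V // ∀ v ∈ (S : Set V), ∀ u, ¬ G.Adj u v} // G.1 ∈ acyclicWith P V} ≃
      {p : Digraph ↥(S : Set V)ᶜ × (↥(S : Set V) → Set ↥(S : Set V)ᶜ) //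
        p.1 ∈ acyclicWith P _ ∧ ∀ s, P (p.2 s).ncard} := by
    refine (Digraph.sourcesEquiv (S : Set V)).subtypeEquiv fun G => ?_
    have h1 := Digraph.isAcyclicDigraph_iff_restrict G.2
    have h2 := Digraph.outDeg_eq_ncard_restrict G.2
    simp only [acyclicWith, Set.mem_ofPred_eq, Digraph.sourcesEquiv, Equiv.coe_fn_mk, h1, h2,
      and_assoc]
    refine and_congr_right fun _ => ⟨fun h => ⟨fun v => h v, fun s => h s⟩, fun h v => ?_⟩
    by_cases hv : v ∈ (S : Set V)
    · exact h.2 ⟨v, hv⟩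
    · exact h.1 ⟨v, hv⟩
  have e3 : {p : Digraph ↥(S : Set V)ᶜ × (↥(S : Set V) → Set ↥(S : Set V)ᶜ) //
        p.1 ∈ acyclicWith P _ ∧ ∀ s, P (p.2 s).ncard} ≃
      acyclicWith P ↥(S : Set V)ᶜ × (↥(S : Set V) → {T : Set ↥(S : Set V)ᶜ // P T.ncard}) :=
    (Equiv.subtypeProdEquivProd (p := (· ∈ acyclicWith P ↥(S : Set V)ᶜ))
      (q := fun f : ↥(S : Set V) → Set ↥(S : Set V)ᶜ => ∀ s, P (f s).ncard)).trans
      (Equiv.prodCongr (Equiv.refl _)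
        (Equiv.subtypePiEquivPi (p := fun _ (T : Set ↥(S : Set V)ᶜ) => P T.ncard)))
  rw [Nat.card_congr (e1.trans (e2.trans e3)), Nat.card_prod, Nat.card_pi, natCard_acyclicWith,
    Finset.prod_const, natCard_subset_eq_subsetCount, hcard, mul_comm]
  simp

/-- Inclusion–exclusion over sets of sources: every acyclic digraph on a nonempty vertex set has
a source, so the alternating sum over sets of sources vanishes. -/
theorem sum_acyclicWithCount (P : ℕ → Prop) {n : ℕ} (hn : n ≠ 0) :
    ∑ k ∈ Finset.range (n + 1), (n.choose k : ℤ) * ((-1) ^ k *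
      (subsetCount P (n - k) ^ k * acyclicWithCount P (n - k))) = 0 := by
  classical
  have : Nonempty (Fin n) := ⟨⟨0, Nat.pos_of_ne_zero hn⟩⟩
  have h := Finset.sum_powerset_apply_card (fun k => (-1 : ℤ) ^ k *
    ((subsetCount P (n - k) : ℤ) ^ k * acyclicWithCount P (n - k)))
    (x := (Finset.univ : Finset (Fin n)))
  simp only [Finset.card_univ, Fintype.card_fin, nsmul_eq_mul] at h
  rw [← h]
  have h2 : ∀ S : Finset (Fin n), (-1 : ℤ) ^ S.card *
      ((subsetCount P (n - S.card) : ℤ) ^ S.card * acyclicWithCount P (n - S.card)) =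
      ∑ G ∈ Finset.univ.filter (· ∈ acyclicWith P (Fin n)),
        if S ∈ G.sources.powerset then (-1 : ℤ) ^ S.card else 0 := by
    intro S
    have h3 := natCard_acyclicWith_sources P S
    rw [Fintype.card_fin, Nat.card_eq_fintype_card, Fintype.card_subtype] at h3
    rw [← Finset.sum_filter, Finset.sum_const, Finset.filter_filter, nsmul_eq_mul, mul_comm]
    simp only [Finset.mem_powerset, h3]
    push_cast
    rfl
  rw [Finset.sum_congr rfl fun S _ => h2 S, Finset.sum_comm]
  refine Finset.sum_eq_zero fun G hG => ?_
  have hG' : G ∈ acyclicWith P (Fin n) := (Finset.mem_filter.1 hG).2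
  have h3 : Finset.univ.powerset.filter (· ∈ G.sources.powerset) = G.sources.powerset := by
    ext S
    simp
  rw [← Finset.sum_filter, h3,
    Finset.sum_powerset_neg_one_pow_card_of_nonempty hG'.1.sources_nonempty]

theorem acyclicWithCount_zero {P : ℕ → Prop} : acyclicWithCount P 0 = 1 := by
  have : Subsingleton (Digraph (Fin 0)) := ⟨fun G H => by ext a; exact a.elim0⟩
  have h : (⊥ : Digraph (Fin 0)) ∈ acyclicWith P (Fin 0) := ⟨fun v => v.elim0, fun v => v.elim0⟩
  rw [acyclicWithCount, Nat.card_eq_one_iff_unique]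
  exact ⟨inferInstance, ⟨⟨_, h⟩⟩⟩

theorem acyclicCount_eq (n : ℕ) : acyclicCount n = acyclicWithCount (fun _ => True) n := by
  simp [acyclicCount, acyclicWithCount, acyclicWith, ← Nat.card_coe_set_eq]

theorem evenAcyclicCount_eq (n : ℕ) : evenAcyclicCount n = acyclicWithCount Even n := by
  simp [evenAcyclicCount, acyclicWithCount, acyclicWith, ← Nat.card_coe_set_eq]

theorem subsetCount_true (m : ℕ) : subsetCount (fun _ => True) m = 2 ^ m := by
  simp [subsetCount]

theorem subsetCount_even_zero : subsetCount Even 0 = 1 := by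
  rw [subsetCount, Nat.card_eq_one_iff_unique]
  exact ⟨inferInstance, ⟨⟨∅, by simp⟩⟩⟩

theorem subsetCount_even_succ (m : ℕ) : subsetCount Even (m + 1) = 2 ^ m := by
  have h1 : subsetCount Even (m + 1) =
      (Finset.univ.filter fun T : Finset (Fin (m + 1)) => Even T.card).card := by
    rw [← Fintype.card_subtype, ← Nat.card_eq_fintype_card]
    exact Nat.card_congr (Fintype.finsetEquivSet.subtypeEquiv fun T => by simp).symm
  have h2 := Finset.sum_powerset_neg_one_pow_card_of_nonempty
    (Finset.univ_nonempty : (Finset.univ : Finset (Fin (m + 1))).Nonempty)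
  have h3 : ∑ T : Finset (Fin (m + 1)), (1 + (-1 : ℤ) ^ T.card) =
      ∑ T : Finset (Fin (m + 1)), if Even T.card then 2 else 0 := by
    refine Finset.sum_congr rfl fun T _ => ?_
    split_ifs with h
    · rw [h.neg_one_pow]; norm_num
    · rw [(Nat.not_even_iff_odd.1 h).neg_one_pow]; norm_num
  rw [Finset.powerset_univ] at h2
  rw [Finset.sum_add_distrib, h2, ← Finset.sum_filter, Finset.sum_const, Finset.sum_const, ← h1,
    Finset.card_univ, Fintype.card_finset, Fintype.card_fin] at h3
  simp only [nsmul_eq_mul, mul_one, add_zero] at h3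
  push_cast at h3
  rw [pow_succ] at h3
  exact_mod_cast (mul_right_cancel₀ two_ne_zero h3).symm

/-! ### Coefficients of reciprocals of power series -/

theorem PowerSeries.coeff_mul_mk_one {R : Type*} [CommRing R] (f : PowerSeries R) (n : ℕ) :
    PowerSeries.coeff n (f * PowerSeries.mk 1) =
      ∑ k ∈ Finset.range (n + 1), PowerSeries.coeff k f := by
  rw [PowerSeries.coeff_mul, Finset.Nat.sum_antidiagonal_eq_sum_range_succ_mk]
  simp

/-- If `s = 1 + s₁X + ⋯` with `∑ |sₙ₊₁| < 1`, then the reciprocal of `s` has absolutely summable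
coefficients. -/
theorem summable_norm_of_mk_mul_mk_eq_one {s h : ℕ → ℝ}
    (hsh : PowerSeries.mk s * PowerSeries.mk h = 1) (h0 : s 0 = 1)
    (hs : Summable fun n => ‖s (n + 1)‖) (hlt : ∑' n, ‖s (n + 1)‖ < 1) :
    Summable fun n => ‖h n‖ := by
  set q := ∑' n, ‖s (n + 1)‖
  have hcoeff : ∀ n, ∑ p ∈ Finset.HasAntidiagonal.antidiagonal n, s p.1 * h p.2 =
      if n = 0 then 1 else 0 := by
    intro n
    have := congrArg (PowerSeries.coeff n) hsh
    simpa [PowerSeries.coeff_mul, PowerSeries.coeff_one] using this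
  have hh0 : h 0 = 1 := by simpa [h0] using hcoeff 0
  have hstep : ∀ n, ‖h (n + 1)‖ ≤ ∑ k ∈ Finset.range (n + 1), ‖s (k + 1)‖ * ‖h (n - k)‖ := by
    intro n
    have h1 := hcoeff (n + 1)
    rw [Finset.Nat.antidiagonal_succ, Finset.sum_cons, Finset.sum_map] at h1
    simp only [h0, one_mul, Nat.add_eq_zero_iff, one_ne_zero, and_false, if_false] at h1
    rw [eq_neg_of_add_eq_zero_left h1, norm_neg]
    refine (norm_sum_le _ _).trans (le_of_eq ?_)
    rw [Finset.Nat.sum_antidiagonal_eq_sum_range_succ_mk]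
    simp
  have hle : ∀ N, ∑ k ∈ Finset.range N, ‖h k‖ ≤ 1 + q * ∑ k ∈ Finset.range N, ‖h k‖ := by
    intro N
    have hq : 0 ≤ q := tsum_nonneg fun _ => norm_nonneg _
    cases N with
    | zero => simp
    | succ N =>
      rw [Finset.sum_range_succ', hh0, norm_one, add_comm]
      gcongr
      calc ∑ n ∈ Finset.range N, ‖h (n + 1)‖
          ≤ ∑ n ∈ Finset.range N, ∑ k ∈ Finset.range (n + 1), ‖s (k + 1)‖ * ‖h (n - k)‖ :=
            Finset.sum_le_sum fun n _ => hstep n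
        _ = ∑ m ∈ Finset.range N, ∑ k ∈ Finset.range (N - m), ‖s (m + 1)‖ * ‖h k‖ :=
            Finset.sum_range_diag_flip N fun k j => ‖s (k + 1)‖ * ‖h j‖
        _ ≤ ∑ m ∈ Finset.range N, ‖s (m + 1)‖ * ∑ k ∈ Finset.range (N + 1), ‖h k‖ := by
            refine Finset.sum_le_sum fun m _ => ?_
            rw [← Finset.mul_sum]
            gcongr
            omega
        _ ≤ q * ∑ k ∈ Finset.range (N + 1), ‖h k‖ := by
            rw [← Finset.sum_mul]
            gcongr
            exact hs.sum_le_tsum _ fun _ _ => norm_nonneg _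
        _ = q * (1 + ∑ n ∈ Finset.range N, ‖h (n + 1)‖) := by
            rw [Finset.sum_range_succ', hh0, norm_one, add_comm]
  refine summable_of_sum_range_le (c := 1 / (1 - q)) (fun _ => norm_nonneg _) fun N => ?_
  rw [le_div_iff₀ (by linarith)]
  linarith [hle N]

/-- If `t = (1 - X) s` where `s = 1 + s₁X + ⋯` with `∑ |sₙ₊₁| < 1`, then the coefficients of `1 / t`
converge to `1 / s(1)`. -/
theorem tendsto_of_mk_mul_mk_eq_one {t s r : ℕ → ℝ}
    (htr : PowerSeries.mk t * PowerSeries.mk r = 1)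
    (hst : ∀ n, s n = ∑ k ∈ Finset.range (n + 1), t k) (h0 : s 0 = 1)
    (hs : Summable fun n => ‖s (n + 1)‖) (hlt : ∑' n, ‖s (n + 1)‖ < 1) :
    Tendsto r atTop (nhds (∑' n, s n)⁻¹) := by
  have hU : (PowerSeries.mk 1 : PowerSeries ℝ) * (1 - PowerSeries.X) = 1 :=
    PowerSeries.mk_one_mul_one_sub_eq_one ℝ
  have hS : PowerSeries.mk s = PowerSeries.mk t * PowerSeries.mk 1 := by
    ext n
    simp [PowerSeries.coeff_mul_mk_one, hst]
  set H : PowerSeries ℝ := (1 - PowerSeries.X) * PowerSeries.mk r with hH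
  set h : ℕ → ℝ := fun n => PowerSeries.coeff n H with hh
  have hHh : PowerSeries.mk h = H := by ext n; simp [hh]
  have hSH : PowerSeries.mk s * PowerSeries.mk h = 1 := by
    rw [hHh, hS, hH, mul_assoc, ← mul_assoc (PowerSeries.mk 1), hU, one_mul, htr]
  have hsum := summable_norm_of_mk_mul_mk_eq_one hSH h0 hs hlt
  have hs' : Summable fun n => ‖s n‖ := (summable_nat_add_iff (f := fun n => ‖s n‖) 1).1 hs
  have hprod : (∑' n, s n) * ∑' n, h n = 1 := by
    rw [tsum_mul_tsum_eq_tsum_sum_antidiagonal_of_summable_norm hs' hsum, tsum_eq_single 0]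
    · have := congrArg (PowerSeries.coeff 0) hSH
      simpa [PowerSeries.coeff_mul] using this
    · intro n hn
      have := congrArg (PowerSeries.coeff n) hSH
      simpa [PowerSeries.coeff_mul, PowerSeries.coeff_one, hn] using this
  have hr : r = fun n => ∑ k ∈ Finset.range (n + 1), h k := by
    ext n
    rw [← PowerSeries.coeff_mul_mk_one, hH, mul_assoc, mul_comm, mul_assoc, hU, mul_one,
      PowerSeries.coeff_mk]
  rw [hr, ← eq_inv_of_mul_eq_one_right hprod]
  exact hsum.of_norm.hasSum.tendsto_sum_nat.comp (tendsto_add_atTop_nat 1)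

/-- Multiplying a power series whose coefficients converge to `L` by one with absolutely summable
coefficients `bₙ` multiplies the limit of the coefficients by `∑ bₙ`. -/
theorem tendsto_coeff_mul_of_summable_norm {b r : ℕ → ℝ} {L : ℝ} (hb : Summable fun n => ‖b n‖)
    (hr : Tendsto r atTop (nhds L)) :
    Tendsto (fun n => PowerSeries.coeff n (PowerSeries.mk b * PowerSeries.mk r)) atTop
      (nhds ((∑' n, b n) * L)) := by
  obtain ⟨M, hM⟩ := (Metric.isBounded_range_of_tendsto r hr).exists_norm_le
  replace hM : ∀ n, ‖r n‖ ≤ M := fun n => hM _ ⟨n, rfl⟩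
  have hconv : ∀ n, PowerSeries.coeff n (PowerSeries.mk b * PowerSeries.mk r) =
      ∑' k, if k ≤ n then b k * r (n - k) else 0 := by
    intro n
    rw [PowerSeries.coeff_mul, Finset.Nat.sum_antidiagonal_eq_sum_range_succ_mk,
      tsum_eq_sum (s := Finset.range (n + 1))]
    · refine Finset.sum_congr rfl fun k hk => ?_
      rw [if_pos (Nat.lt_succ_iff.1 (Finset.mem_range.1 hk))]
      simp
    · intro k hk
      rw [if_neg fun h => hk (Finset.mem_range.2 (Nat.lt_succ_iff.2 h))]
  simp only [hconv]
  rw [← tsum_mul_right]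
  refine tendsto_tsum_of_dominated_convergence (bound := fun k => ‖b k‖ * M) (hb.mul_right M)
    (fun k => ?_) (Eventually.of_forall fun n k => ?_)
  · have h1 : Tendsto (fun n => b k * r (n - k)) atTop (nhds (b k * L)) :=
      (hr.comp (tendsto_sub_atTop_nat k)).const_mul _
    refine h1.congr' ?_
    filter_upwards [eventually_ge_atTop k] with n hn
    rw [if_pos hn]
  · have hM0 : 0 ≤ M := (norm_nonneg _).trans (hM 0)
    split_ifs
    · rw [norm_mul]
      exact mul_le_mul_of_nonneg_left (hM _) (norm_nonneg _)
    · rw [norm_zero]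
      positivity

/-- Summation by parts: `∑ tₙ wⁿ = (1 - w) ∑ sₙ wⁿ` on the closed unit disc, where the `sₙ` are
the partial sums of `∑ tₙ`. -/
theorem tsum_mul_pow_eq_one_sub_mul {t s : ℕ → ℝ}
    (hst : ∀ n, s n = ∑ k ∈ Finset.range (n + 1), t k) (hs : Summable fun n => ‖s n‖)
    {w : ℂ} (hw : ‖w‖ ≤ 1) :
    ∑' n, (t n : ℂ) * w ^ n = (1 - w) * ∑' n, (s n : ℂ) * w ^ n := by
  have hsw : Summable fun n => (s n : ℂ) * w ^ n := by
    refine Summable.of_norm_bounded hs fun n => ?_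
    rw [norm_mul, Complex.norm_real, norm_pow]
    exact mul_le_of_le_one_right (norm_nonneg _) (pow_le_one₀ (norm_nonneg _) hw)
  have hsw1 : Summable fun n => (s (n + 1) : ℂ) * w ^ (n + 1) := (summable_nat_add_iff 1).2 hsw
  have ht : ∀ n, (t (n + 1) : ℂ) * w ^ (n + 1) =
      (s (n + 1) : ℂ) * w ^ (n + 1) - w * ((s n : ℂ) * w ^ n) := by
    intro n
    rw [hst (n + 1), Finset.sum_range_succ, ← hst n]
    push_cast
    ring
  have ht1 : Summable fun n => (t (n + 1) : ℂ) * w ^ (n + 1) := by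
    simp only [ht]
    exact hsw1.sub (hsw.mul_left w)
  rw [((summable_nat_add_iff (f := fun n => (t n : ℂ) * w ^ n) 1).1 ht1).tsum_eq_zero_add]
  simp only [ht]
  rw [hsw1.tsum_sub (hsw.mul_left w), tsum_mul_left, sub_mul, one_mul,
    hsw.tsum_eq_zero_add]
  simp only [hst 0, zero_add, Finset.sum_range_one, pow_zero, mul_one]
  ring

theorem tsum_mul_pow_ne_zero {s : ℕ → ℝ} (h0 : s 0 = 1)
    (hs : Summable fun n => ‖s (n + 1)‖) (hlt : ∑' n, ‖s (n + 1)‖ < 1) {w : ℂ} (hw : ‖w‖ ≤ 1) :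
    ∑' n, (s n : ℂ) * w ^ n ≠ 0 := by
  have hle : ∀ n, ‖(s (n + 1) : ℂ) * w ^ (n + 1)‖ ≤ ‖s (n + 1)‖ := fun n => by
    rw [norm_mul, Complex.norm_real, norm_pow]
    exact mul_le_of_le_one_right (norm_nonneg _) (pow_le_one₀ (norm_nonneg _) hw)
  have hsw1 : Summable fun n => (s (n + 1) : ℂ) * w ^ (n + 1) := .of_norm_bounded hs hle
  have hbound := tsum_of_norm_bounded hs.hasSum hle
  rw [((summable_nat_add_iff (f := fun n => (s n : ℂ) * w ^ n) 1).1 hsw1).tsum_eq_zero_add]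
  intro h
  rw [h0, Complex.ofReal_one, pow_zero, mul_one] at h
  rw [eq_neg_of_add_eq_zero_right h, norm_neg, norm_one] at hbound
  linarith

/-! ### The series `F` -/

/-- The `n`-th term `xⁿ / (n! 2^(n choose 2))` of the series defining `F(x)`. -/
noncomputable def chromaticTerm {𝕜 : Type*} [RCLike 𝕜] (x : 𝕜) (n : ℕ) : 𝕜 :=
  x ^ n / ((n.factorial : 𝕜) * 2 ^ n.choose 2)

section
variable {𝕜 : Type*} [RCLike 𝕜]

theorem chromaticF_eq_tsum (x : 𝕜) : chromaticF x = ∑' n, chromaticTerm x n := rfl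

theorem summable_norm_chromaticTerm (x : 𝕜) : Summable fun n => ‖chromaticTerm x n‖ :=
  summable_norm_chromaticF x

theorem choose_succ_two (n : ℕ) : (n + 1).choose 2 = n.choose 2 + n := by
  rw [Nat.choose_succ_succ' n 1, Nat.choose_one_right, add_comm]

theorem chromaticTerm_succ (x : 𝕜) (n : ℕ) :
    chromaticTerm x (n + 1) = chromaticTerm x n * (x / ((n + 1) * 2 ^ n)) := by
  have h1 : (n.factorial : 𝕜) ≠ 0 := by exact_mod_cast n.factorial_ne_zero
  have h2 : (n + 1 : 𝕜) ≠ 0 := by exact_mod_cast n.succ_ne_zero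
  rw [chromaticTerm, chromaticTerm, choose_succ_two, Nat.factorial_succ, pow_add, pow_succ]
  push_cast
  field_simp
  ring

theorem succ_mul_chromaticTerm_succ (x : 𝕜) (n : ℕ) :
    (n + 1) * chromaticTerm x (n + 1) = x * chromaticTerm (x / 2) n := by
  have h2 : (n + 1 : 𝕜) ≠ 0 := by exact_mod_cast n.succ_ne_zero
  rw [chromaticTerm_succ, chromaticTerm, chromaticTerm, div_pow]
  field_simp

/-- From the third term on, the series decays at least geometrically with ratio `1 / 2` on the disc
of radius `3`, which contains both `α` and `2α`. -/
theorem norm_chromaticTerm_succ_le {x : 𝕜} (hx : ‖x‖ ≤ 3) {n : ℕ} (hn : 2 ≤ n) :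
    ‖chromaticTerm x (n + 1)‖ ≤ ‖chromaticTerm x n‖ * (1 / 2) := by
  rw [chromaticTerm_succ, norm_mul]
  gcongr
  have h1 : ‖(n + 1 : 𝕜)‖ = n + 1 := by
    rw [← Nat.cast_succ, RCLike.norm_natCast, Nat.cast_succ]
  rw [norm_div, norm_mul, norm_pow, h1, RCLike.norm_ofNat, div_le_div_iff₀ (by positivity) two_pos]
  have h2 : (2 : ℝ) ≤ n := by exact_mod_cast hn
  have h3 : (4 : ℝ) ≤ 2 ^ n := by
    calc (4 : ℝ) = 2 ^ 2 := by norm_num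
      _ ≤ 2 ^ n := pow_le_pow_right₀ one_le_two hn
  nlinarith

theorem norm_chromaticTerm_add_le {x : 𝕜} (hx : ‖x‖ ≤ 3) {n : ℕ} (hn : 2 ≤ n) (k : ℕ) :
    ‖chromaticTerm x (n + k)‖ ≤ ‖chromaticTerm x n‖ * (1 / 2) ^ k := by
  induction k with
  | zero => simp
  | succ k ih =>
    rw [← add_assoc, pow_succ, ← mul_assoc]
    exact (norm_chromaticTerm_succ_le hx (by omega)).trans (by gcongr)

theorem hasSum_mul_half_pow (c : ℝ) : HasSum (fun k : ℕ => c * (1 / 2) ^ k) (2 * c) := by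
  rw [mul_comm]
  exact hasSum_geometric_two.mul_left c

theorem tsum_norm_chromaticTerm_add_le {x : 𝕜} (hx : ‖x‖ ≤ 3) {n : ℕ} (hn : 2 ≤ n) :
    ∑' k, ‖chromaticTerm x (n + k)‖ ≤ 2 * ‖chromaticTerm x n‖ := by
  rw [← (hasSum_mul_half_pow _).tsum_eq]
  refine Summable.tsum_le_tsum (norm_chromaticTerm_add_le hx hn) ?_ (hasSum_mul_half_pow _).summable
  exact .of_nonneg_of_le (fun _ => norm_nonneg _) (norm_chromaticTerm_add_le hx hn)
    (hasSum_mul_half_pow _).summable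

theorem norm_chromaticF_sub_sum_le {x : 𝕜} (hx : ‖x‖ ≤ 3) {n : ℕ} (hn : 2 ≤ n) :
    ‖chromaticF x - ∑ k ∈ Finset.range n, chromaticTerm x k‖ ≤ 2 * ‖chromaticTerm x n‖ := by
  rw [chromaticF_eq_tsum, ← (summable_norm_chromaticTerm x).of_norm.sum_add_tsum_nat_add n,
    add_sub_cancel_left]
  refine tsum_of_norm_bounded (hasSum_mul_half_pow _) fun k => ?_
  rw [add_comm]
  exact norm_chromaticTerm_add_le hx hn k

/-- The functional equation `F'(x) = F(x / 2)`. -/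
theorem hasDerivAt_chromaticF (x : 𝕜) : HasDerivAt (chromaticF : 𝕜 → 𝕜) (chromaticF (x / 2)) x := by
  set R : ℝ := ‖x‖ + 1
  have hd : ∀ (n : ℕ) (y : 𝕜), HasDerivAt (fun z => chromaticTerm z (n + 1))
      (chromaticTerm (y / 2) n) y := by
    intro n y
    have h := (hasDerivAt_pow (n + 1) y).div_const (((n + 1).factorial : 𝕜) * 2 ^ (n + 1).choose 2)
    refine h.congr_deriv ?_
    have h1 : (n.factorial : 𝕜) ≠ 0 := by exact_mod_cast n.factorial_ne_zero
    have h2 : (n + 1 : 𝕜) ≠ 0 := by exact_mod_cast n.succ_ne_zero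
    rw [chromaticTerm, choose_succ_two, Nat.factorial_succ, pow_add, div_pow]
    push_cast
    field_simp
  have hsucc : ∀ y : 𝕜, chromaticF y = ∑' n, chromaticTerm y (n + 1) + 1 := fun y => by
    rw [chromaticF_eq_tsum, (summable_norm_chromaticTerm y).of_norm.tsum_eq_zero_add, add_comm]
    simp [chromaticTerm]
  refine HasDerivAt.congr_of_eventuallyEq (HasDerivAt.add_const _ ?_) (.of_forall hsucc)
  rw [chromaticF_eq_tsum]
  refine hasDerivAt_tsum_of_isPreconnected (u := fun n => ‖chromaticTerm (R / 2) n‖)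
    (t := Metric.ball 0 R) (y₀ := 0) (summable_norm_chromaticTerm (R / 2)) Metric.isOpen_ball
    (convex_ball 0 R).isPreconnected (fun n y _ => hd n y) (fun n y hy => ?_)
    (Metric.mem_ball_self (by positivity)) ?_ (by simp [R])
  · rw [mem_ball_zero_iff] at hy
    have hR : 0 ≤ R := by positivity
    simp only [chromaticTerm, norm_div, norm_mul, norm_pow, RCLike.norm_natCast, RCLike.norm_ofNat,
      Real.norm_of_nonneg hR]
    gcongr
  · simp [chromaticTerm]

theorem ofReal_chromaticF (x : ℝ) : ((chromaticF x : ℝ) : ℂ) = chromaticF (x : ℂ) := by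
  simp [chromaticF, Complex.ofReal_tsum]

end

/-! ### Generating functions of the counting sequences -/

/-- The identity that makes the weight `2 ^ (n choose 2)` absorb the `2 ^ (k m)` possible sets of
edges from `k` sources to `m` other vertices. -/
theorem add_choose_two (k m : ℕ) : (k + m).choose 2 = k.choose 2 + m.choose 2 + m * k := by
  induction m with
  | zero => simp
  | succ m ih => rw [← add_assoc, choose_succ_two, choose_succ_two, ih]; ring

/-- Matches a summand of a Cauchy product of generating functions with a summand of the recursion in
which `k` sources are attached to a structure on `m` vertices, counted by `A`. -/
theorem chromaticTerm_mul (x A : ℝ) (k m : ℕ) :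
    chromaticTerm x k * (A / (m.factorial * 2 ^ m.choose 2) * (-x) ^ m) =
      chromaticTerm (-x) (k + m) *
        ((k + m).choose k * ((-1) ^ k * ((2 ^ m) ^ k * A))) := by
  have h1 : ((k + m).choose k : ℝ) * k.factorial * m.factorial = (k + m).factorial := by
    have h := Nat.choose_mul_factorial_mul_factorial (Nat.le_add_right k m)
    rw [Nat.add_sub_cancel_left] at h
    exact_mod_cast h
  have h2 : ((k + m).factorial : ℝ) ≠ 0 := by positivity
  have h3 : ((k + m).choose k : ℝ) = (k + m).factorial / (k.factorial * m.factorial) := by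
    rw [← h1]; field_simp
  have h4 : ((-1 : ℝ) ^ k) * (-1) ^ k = 1 := by rw [← mul_pow]; norm_num
  rw [chromaticTerm, chromaticTerm, add_choose_two, h3, pow_add, pow_add, pow_add, ← pow_mul,
    neg_pow x k]
  field_simp
  linear_combination (-A * x ^ k * (-x) ^ m) * h4

/-- `∑ Rₙ xⁿ / (n! 2^(n choose 2)) = 1 / F(-x)`, with the variable scaled by `-x`. -/
theorem mk_chromaticTerm_mul_acyclicCount (x : ℝ) :
    PowerSeries.mk (chromaticTerm x) * PowerSeries.mk (fun n =>
      (acyclicCount n : ℝ) / (n.factorial * 2 ^ n.choose 2) * (-x) ^ n) = 1 := by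
  ext n
  rw [PowerSeries.coeff_mul, Finset.Nat.sum_antidiagonal_eq_sum_range_succ_mk,
    PowerSeries.coeff_one]
  split_ifs with hn
  · subst hn
    simp [chromaticTerm, acyclicCount_eq, acyclicWithCount_zero]
  have h := congrArg (fun z : ℤ => chromaticTerm (-x) n * (z : ℝ))
    (sum_acyclicWithCount (fun _ => True) hn)
  simp only [Int.cast_zero, mul_zero] at h
  rw [← h, Int.cast_sum, Finset.mul_sum]
  refine Finset.sum_congr rfl fun k hk => ?_
  obtain ⟨m, rfl⟩ := Nat.exists_eq_add_of_le (Nat.lt_succ_iff.1 (Finset.mem_range.1 hk))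
  simp only [PowerSeries.coeff_mk, Nat.add_sub_cancel_left, chromaticTerm_mul, acyclicCount_eq,
    subsetCount_true]
  push_cast
  ring

/-- `F(-x) ∑ Oₙ (2x)ⁿ / (n! 2^(n choose 2)) = 1 - F(-2x) + F(-x)`, with the variable scaled
by `-x`. Each source has `2 ^ (m - 1)` even sets of out-neighbours among `m ≥ 1` other vertices; this
halving is absorbed by doubling the variable, and `m = 0` produces the correction on the right. -/
theorem mk_chromaticTerm_mul_evenAcyclicCount (x : ℝ) :
    PowerSeries.mk (chromaticTerm x) * PowerSeries.mk (fun n =>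
      (evenAcyclicCount n : ℝ) / (n.factorial * 2 ^ n.choose 2) * (-(2 * x)) ^ n) =
      1 - PowerSeries.mk (chromaticTerm (2 * x)) + PowerSeries.mk (chromaticTerm x) := by
  ext n
  rw [PowerSeries.coeff_mul, Finset.Nat.sum_antidiagonal_eq_sum_range_succ_mk]
  simp only [map_add, map_sub, PowerSeries.coeff_mk, PowerSeries.coeff_one]
  split_ifs with hn
  · subst hn
    simp [chromaticTerm, evenAcyclicCount_eq, acyclicWithCount_zero]
  have h := congrArg (fun z : ℤ => chromaticTerm (-(2 * x)) n * (z : ℝ))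
    (sum_acyclicWithCount Even hn)
  simp only [Int.cast_zero, mul_zero] at h
  -- the summand `k = n` is exceptional: the empty set has one even subset, not `1 / 2`
  rw [Int.cast_sum, Finset.mul_sum, Finset.sum_range_succ] at h
  rw [Finset.sum_range_succ]
  have hmain : ∀ k ∈ Finset.range n, chromaticTerm x k * ((evenAcyclicCount (n - k) : ℝ) /
      ((n - k).factorial * 2 ^ (n - k).choose 2) * (-(2 * x)) ^ (n - k)) =
      chromaticTerm (-(2 * x)) n * (((n.choose k : ℤ) * ((-1) ^ k *
        (subsetCount Even (n - k) ^ k * acyclicWithCount Even (n - k))) : ℤ) : ℝ) := by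
    intro k hk
    obtain ⟨m, rfl⟩ := Nat.exists_eq_add_of_lt (Finset.mem_range.1 hk)
    have h1 := chromaticTerm_mul x ((evenAcyclicCount (m + 1) : ℝ) * 2 ^ (m + 1)) k (m + 1)
    have h2 : chromaticTerm (-(2 * x)) (k + (m + 1)) =
        2 ^ (k + (m + 1)) * chromaticTerm (-x) (k + (m + 1)) := by
      rw [chromaticTerm, chromaticTerm, ← mul_neg, mul_pow, mul_div_assoc]
    rw [add_assoc, Nat.add_sub_cancel_left, subsetCount_even_succ, ← evenAcyclicCount_eq, h2]
    rw [show (-(2 * x)) ^ (m + 1) = 2 ^ (m + 1) * (-x) ^ (m + 1) by rw [← mul_neg, mul_pow]]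
    push_cast
    rw [show ((2 : ℝ) ^ (m + 1)) ^ k = 2 ^ k * (2 ^ m) ^ k by
      rw [← pow_mul, ← pow_mul, ← pow_add]; ring_nf] at h1
    rw [pow_add 2 k (m + 1)]
    linear_combination h1
  rw [Finset.sum_congr rfl hmain]
  have hlast : chromaticTerm (-(2 * x)) n * (((n.choose n : ℤ) * ((-1) ^ n *
        (subsetCount Even (n - n) ^ n * acyclicWithCount Even (n - n))) : ℤ) : ℝ) =
      chromaticTerm (2 * x) n := by
    rw [Nat.sub_self, subsetCount_even_zero, acyclicWithCount_zero, chromaticTerm, chromaticTerm,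
      neg_pow (2 * x), Nat.choose_self]
    have h4 : ((-1 : ℝ) ^ n) * (-1) ^ n = 1 := by rw [← mul_pow]; norm_num
    push_cast
    field_simp
    linear_combination (2 * x) ^ n * h4
  rw [hlast] at h
  simp only [Nat.sub_self, evenAcyclicCount_eq, acyclicWithCount_zero]
  simp only [Nat.cast_one, Nat.factorial_zero, Nat.choose_zero_succ, pow_zero, mul_one, div_one]
  linear_combination h

/-! ### The zero of smallest modulus -/

/-- A sign change, certified by the first seven terms of the series, locates the zero `α` more
precisely than to three decimal places; this precision is used in the estimate of `F(2α)`. -/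
theorem exists_chromaticF_eq_zero :
    ∃ α : ℝ, -1.48809 < α ∧ α < -1.48807 ∧ chromaticF α = 0 := by
  have hcont : ContinuousOn (chromaticF : ℝ → ℝ) (Set.Icc (-1.48809) (-1.48807)) :=
    fun x _ => (hasDerivAt_chromaticF x).continuousAt.continuousWithinAt
  have h1 : (chromaticF (-1.48809 : ℝ) : ℝ) < 0 := by
    have h := norm_chromaticF_sub_sum_le (x := (-1.48809 : ℝ)) (by norm_num) (n := 7) (by norm_num)
    simp only [Finset.sum_range_succ, Finset.sum_range_zero, chromaticTerm, Nat.factorial,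
      Nat.choose, Real.norm_eq_abs] at h
    norm_num at h
    linarith [(abs_le.1 h).2]
  have h2 : (0 : ℝ) < chromaticF (-1.48807 : ℝ) := by
    have h := norm_chromaticF_sub_sum_le (x := (-1.48807 : ℝ)) (by norm_num) (n := 7) (by norm_num)
    simp only [Finset.sum_range_succ, Finset.sum_range_zero, chromaticTerm, Nat.factorial,
      Nat.choose, Real.norm_eq_abs] at h
    norm_num at h
    linarith [(abs_le.1 h).1]
  obtain ⟨α, ⟨ha, hb⟩, hα⟩ := intermediate_value_Ioo (by norm_num) hcont ⟨h1, h2⟩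
  exact ⟨α, ha, hb, hα⟩

theorem abs_chromaticF_two_mul_sub_lt {α : ℝ} (h1 : -1.48809 < α) (h2 : α < -1.48807) :
    |1 - chromaticF (2 * α) - 1.262| < 0.0005 := by
  obtain ⟨y, rfl⟩ : ∃ y, α = -y := ⟨-α, by ring⟩
  replace h1 : y < 1.48809 := by linarith
  replace h2 : 1.48807 < y := by linarith
  have hy : |2 * -y| ≤ 3 := by rw [abs_le]; constructor <;> linarith
  have h := norm_chromaticF_sub_sum_le (x := 2 * -y) hy (n := 6) (by norm_num)
  simp only [Finset.sum_range_succ, Finset.sum_range_zero, chromaticTerm, Nat.factorial,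
    Nat.choose, Real.norm_eq_abs, abs_div, abs_pow] at h
  norm_num at h
  rw [abs_of_pos (by linarith : 0 < y)] at h
  have l2 : (1.48807 : ℝ) ^ 2 < y ^ 2 := by gcongr
  have l3 : (1.48807 : ℝ) ^ 3 < y ^ 3 := by gcongr
  have l4 : (1.48807 : ℝ) ^ 4 < y ^ 4 := by gcongr
  have l5 : (1.48807 : ℝ) ^ 5 < y ^ 5 := by gcongr
  have u2 : y ^ 2 < (1.48809 : ℝ) ^ 2 := by gcongr
  have u3 : y ^ 3 < (1.48809 : ℝ) ^ 3 := by gcongr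
  have u4 : y ^ 4 < (1.48809 : ℝ) ^ 4 := by gcongr
  have u5 : y ^ 5 < (1.48809 : ℝ) ^ 5 := by gcongr
  have u6 : y ^ 6 < (1.48809 : ℝ) ^ 6 := by gcongr
  norm_num at l2 l3 l4 l5 u2 u3 u4 u5 u6
  obtain ⟨ha, hb⟩ := abs_le.1 h
  ring_nf at ha hb
  rw [abs_lt]
  constructor <;> ring_nf <;> linarith

/-- The partial sums of the series defining `F(α)`. -/
noncomputable def chromaticPartialSum (α : ℝ) (n : ℕ) : ℝ :=
  ∑ k ∈ Finset.range (n + 1), chromaticTerm α k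

section
variable {α : ℝ}

theorem chromaticPartialSum_zero : chromaticPartialSum α 0 = 1 := by
  simp [chromaticPartialSum, chromaticTerm]

/-- Since `F(α) = 0`, a partial sum is the negative of the tail that follows it. -/
theorem norm_chromaticPartialSum_succ_le (hα : |α| ≤ 3) (h0 : chromaticF α = 0) (n : ℕ) :
    ‖chromaticPartialSum α (n + 1)‖ ≤ 2 * ‖chromaticTerm α (n + 2)‖ := by
  have h := norm_chromaticF_sub_sum_le (x := α) hα (n := n + 2) (by omega)
  rwa [h0, zero_sub, norm_neg] at h

theorem summable_norm_chromaticPartialSum_succ (hα : |α| ≤ 3) (h0 : chromaticF α = 0) :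
    Summable fun n => ‖chromaticPartialSum α (n + 1)‖ :=
  .of_nonneg_of_le (fun _ => norm_nonneg _) (norm_chromaticPartialSum_succ_le hα h0)
    (((summable_nat_add_iff 2).2 (summable_norm_chromaticTerm α)).mul_left 2)

/-- The inequality on which the dominance of `α` rests: the first two summands are about `0.488`
and `0.066`, and the others are controlled by the fifth term of the series. -/
theorem tsum_norm_chromaticPartialSum_succ_lt (h1 : -1.48809 < α) (h2 : α < -1.48807)
    (h0 : chromaticF α = 0) : ∑' n, ‖chromaticPartialSum α (n + 1)‖ < 1 := by
  have hα : |α| ≤ 3 := by rw [abs_le]; constructor <;> linarith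
  have hs := summable_norm_chromaticPartialSum_succ hα h0
  have ht : Summable fun n => ‖chromaticTerm α (4 + n)‖ := by
    simp only [add_comm 4]
    exact (summable_nat_add_iff (f := fun n => ‖chromaticTerm α n‖) 4).2
      (summable_norm_chromaticTerm α)
  have htail : ∑' n, ‖chromaticPartialSum α (n + 2 + 1)‖ ≤ 2 * (2 * ‖chromaticTerm α 4‖) := by
    refine le_trans ?_ (mul_le_mul_of_nonneg_left
      (tsum_norm_chromaticTerm_add_le (x := α) hα (n := 4) (by norm_num)) two_pos.le)
    rw [← tsum_mul_left]
    refine ((summable_nat_add_iff 2).2 hs).tsum_le_tsum (fun n => ?_) (ht.mul_left 2)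
    rw [show 4 + n = n + 2 + 2 by ring]
    exact norm_chromaticPartialSum_succ_le hα h0 (n + 2)
  rw [← hs.sum_add_tsum_nat_add 2]
  have e1 : ‖chromaticPartialSum α 1‖ < 0.4881 := by
    simp only [chromaticPartialSum, Finset.sum_range_succ, Finset.sum_range_zero, chromaticTerm,
      Nat.factorial, Nat.choose, Real.norm_eq_abs]
    norm_num
    rw [abs_lt]
    constructor <;> linarith
  have e2 : ‖chromaticPartialSum α 2‖ < 0.1 := by
    simp only [chromaticPartialSum, Finset.sum_range_succ, Finset.sum_range_zero, chromaticTerm,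
      Nat.factorial, Nat.choose, Real.norm_eq_abs]
    norm_num
    rw [abs_lt]
    constructor <;> nlinarith
  have e4 : ‖chromaticTerm α 4‖ < 0.01 := by
    simp only [chromaticTerm, Nat.factorial, Nat.choose, norm_div, norm_pow]
    have : ‖α‖ ^ 4 ≤ 1.5 ^ 4 := by
      gcongr
      rw [Real.norm_eq_abs, abs_le]
      constructor <;> linarith
    norm_num at this ⊢
    linarith
  simp only [Finset.sum_range_succ, Finset.sum_range_zero]
  linarith

/-- Summation by parts: `∑ sₙ = -∑ n tₙ = -α F'(α)` for the partial sums `sₙ` of `∑ tₙ = F(α) = 0`. -/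
theorem tsum_chromaticPartialSum (hα : |α| ≤ 3) (h0 : chromaticF α = 0) :
    ∑' n, chromaticPartialSum α n = -(α * chromaticF (α / 2)) := by
  have hs : Summable (chromaticPartialSum α) :=
    (summable_nat_add_iff 1).1 (summable_norm_chromaticPartialSum_succ hα h0).of_norm
  have hparts : ∀ N : ℕ, ∑ n ∈ Finset.range (N + 1), chromaticPartialSum α n =
      (N + 1) * chromaticPartialSum α (N + 1)
        - α * ∑ n ∈ Finset.range (N + 1), chromaticTerm (α / 2) n := by
    intro N
    rw [Finset.mul_sum, Finset.sum_congr rfl fun n _ => (succ_mul_chromaticTerm_succ α n).symm]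
    induction N with
    | zero => simp [chromaticPartialSum, Finset.sum_range_succ]
    | succ N ih =>
      have hsucc : chromaticPartialSum α (N + 2) =
          chromaticPartialSum α (N + 1) + chromaticTerm α (N + 2) := Finset.sum_range_succ _ _
      rw [Finset.sum_range_succ, ih, Finset.sum_range_succ _ (N + 1), hsucc]
      push_cast
      ring
  have hzero : Tendsto (fun N : ℕ => (N + 1) * chromaticPartialSum α (N + 1)) atTop (nhds 0) := by
    have hlim : Tendsto (fun N : ℕ => 2 * ‖α * chromaticTerm (α / 2) (N + 1)‖) atTop (nhds 0) := by
      have := ((summable_norm_chromaticTerm (α / 2)).of_norm.tendsto_atTop_zero.comp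
        (tendsto_add_atTop_nat 1)).const_mul α |>.norm.const_mul 2
      simpa using this
    refine squeeze_zero_norm (fun N => ?_) hlim
    rw [← succ_mul_chromaticTerm_succ, norm_mul, norm_mul, mul_left_comm]
    have hN : ‖(N + 1 : ℝ)‖ ≤ ‖(((N + 1 : ℕ) : ℝ) + 1)‖ := by
      rw [Real.norm_of_nonneg (by positivity), Real.norm_of_nonneg (by positivity)]
      push_cast
      linarith
    exact mul_le_mul hN (norm_chromaticPartialSum_succ_le hα h0 N) (norm_nonneg _) (norm_nonneg _)
  have hlim := hzero.sub (((summable_norm_chromaticTerm (α / 2)).of_norm.hasSum.tendsto_sum_nat.comp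
    (tendsto_add_atTop_nat 1)).const_mul α)
  rw [zero_sub, ← chromaticF_eq_tsum] at hlim
  refine tendsto_nhds_unique (hs.hasSum.tendsto_sum_nat.comp (tendsto_add_atTop_nat 1))
    (hlim.congr fun N => (hparts N).symm)

/-- On the disc `|z| ≤ |α|` one has `F(z) = (1 - z/α) ∑ sₙ (z/α)ⁿ`, where the sum is nonzero because
its constant term dominates. -/
theorem chromaticF_ne_zero_of_norm_le (hα0 : α ≠ 0) (hα : |α| ≤ 3) (h0 : chromaticF α = 0)
    (hlt : ∑' n, ‖chromaticPartialSum α (n + 1)‖ < 1) {z : ℂ} (hz : ‖z‖ ≤ |α|)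
    (hne : z ≠ (α : ℂ)) : chromaticF z ≠ 0 := by
  have hαC : (α : ℂ) ≠ 0 := Complex.ofReal_ne_zero.2 hα0
  have hs := summable_norm_chromaticPartialSum_succ hα h0
  have hw : ‖z / α‖ ≤ 1 := by
    rw [norm_div, Complex.norm_real, Real.norm_eq_abs]
    exact div_le_one_of_le₀ hz (abs_nonneg _)
  have hF : chromaticF z = ∑' n, ((chromaticTerm α n : ℝ) : ℂ) * (z / α) ^ n := by
    rw [chromaticF_eq_tsum]
    refine tsum_congr fun n => ?_
    simp only [chromaticTerm]
    push_cast
    rw [div_pow]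
    field_simp
  rw [hF, tsum_mul_pow_eq_one_sub_mul (s := chromaticPartialSum α) (fun _ => rfl)
    ((summable_nat_add_iff (f := fun n => ‖chromaticPartialSum α n‖) 1).1 hs) hw]
  refine mul_ne_zero (sub_ne_zero.2 fun h => hne ?_)
    (tsum_mul_pow_ne_zero chromaticPartialSum_zero hs hlt hw)
  rw [eq_div_iff hαC, one_mul] at h
  exact h.symm

/-! ### Asymptotics of the counting sequences -/

theorem tendsto_acyclicCount (hα : |α| ≤ 3) (h0 : chromaticF α = 0)
    (hlt : ∑' n, ‖chromaticPartialSum α (n + 1)‖ < 1) :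
    Tendsto (fun n => (acyclicCount n : ℝ) / (n.factorial * 2 ^ n.choose 2) * (-α) ^ n) atTop
      (nhds (-1 / (α * chromaticF (α / 2)))) := by
  have h := tendsto_of_mk_mul_mk_eq_one (mk_chromaticTerm_mul_acyclicCount α)
    (s := chromaticPartialSum α) (fun _ => rfl) chromaticPartialSum_zero
    (summable_norm_chromaticPartialSum_succ hα h0) hlt
  rwa [tsum_chromaticPartialSum hα h0, inv_neg, inv_eq_one_div, ← neg_div] at h

/-- The generating function of the even counts is that of all acyclic digraphs, multiplied by
`1 - F(2x)`, plus the constant `1`; the factor is entire, so it multiplies the limit of the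
coefficients by its value `1 - F(2α)`. -/
theorem tendsto_evenAcyclicCount (hα : |α| ≤ 3) (h0 : chromaticF α = 0)
    (hlt : ∑' n, ‖chromaticPartialSum α (n + 1)‖ < 1) :
    Tendsto (fun n => (evenAcyclicCount n : ℝ) / (n.factorial * 2 ^ n.choose 2) * (-(2 * α)) ^ n)
      atTop (nhds (-(1 - chromaticF (2 * α)) / (α * chromaticF (α / 2)))) := by
  have hR := mk_chromaticTerm_mul_acyclicCount α
  have hO := mk_chromaticTerm_mul_evenAcyclicCount α
  set r : ℕ → ℝ := fun n => (acyclicCount n : ℝ) / (n.factorial * 2 ^ n.choose 2) * (-α) ^ n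
  set o : ℕ → ℝ := fun n =>
    (evenAcyclicCount n : ℝ) / (n.factorial * 2 ^ n.choose 2) * (-(2 * α)) ^ n
  set b : ℕ → ℝ := fun n => (if n = 0 then 1 else 0) - chromaticTerm (2 * α) n
  have hb : PowerSeries.mk b = 1 - PowerSeries.mk (chromaticTerm (2 * α)) := by
    ext n
    simp [b, PowerSeries.coeff_one]
  have ho : PowerSeries.mk o = PowerSeries.mk b * PowerSeries.mk r + 1 := by
    rw [hb]
    linear_combination PowerSeries.mk r * hO - (PowerSeries.mk o - 1) * hR
  have hsum1 : HasSum (fun n : ℕ => if n = 0 then (1 : ℝ) else 0) 1 := hasSum_ite_eq 0 1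
  have hsum : HasSum b (1 - chromaticF (2 * α)) :=
    hsum1.sub (summable_norm_chromaticTerm (2 * α)).of_norm.hasSum
  have h := tendsto_coeff_mul_of_summable_norm hsum.summable.norm (tendsto_acyclicCount hα h0 hlt)
  rw [hsum.tsum_eq, mul_div_assoc', mul_neg_one] at h
  refine h.congr' ?_
  filter_upwards [eventually_ne_atTop 0] with n hn
  have := congrArg (PowerSeries.coeff n) ho
  rw [map_add, PowerSeries.coeff_one, if_neg hn, add_zero, PowerSeries.coeff_mk] at this
  exact this.symm

end

theorem isEquivalent_of_tendsto_normalized {u : ℕ → ℕ} {β c : ℝ} (hβ : β ≠ 0) (hc : c ≠ 0)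
    (h : Tendsto (fun n => (u n : ℝ) / (n.factorial * 2 ^ n.choose 2) * (-β) ^ n) atTop (nhds c)) :
    (fun n => (u n : ℝ)) ~[atTop]
      (fun n : ℕ => c * 2 ^ n.choose 2 * (n.factorial : ℝ) * (-1 / β) ^ n) := by
  have h1 := ((isEquivalent_const_iff_tendsto hc).2 h).mul
    (IsEquivalent.refl (u := fun n : ℕ => 2 ^ n.choose 2 * (n.factorial : ℝ) * (-1 / β) ^ n))
  refine (h1.congr_left (.of_forall fun n => ?_)).congr_right (.of_forall fun n => ?_)
  · have h2 : (-β) ^ n * (-1 / β) ^ n = 1 := by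
      rw [← mul_pow, show -β * (-1 / β) = 1 by field_simp, one_pow]
    have h3 : (n.factorial : ℝ) ≠ 0 := by positivity
    simp only [Pi.mul_apply]
    calc _ = (u n : ℝ) / (n.factorial * 2 ^ n.choose 2) * (n.factorial * 2 ^ n.choose 2) *
          ((-β) ^ n * (-1 / β) ^ n) := by ring
      _ = u n := by rw [h2, mul_one, div_mul_cancel₀ _ (by positivity)]
  · simp only [Pi.mul_apply, Function.const_apply]
    ring

theorem mainTheorem3 :
    ∃ α C K : ℝ,
      -- `α ≈ -1.488` is a simple zero of the entire function `F`, of strictly smallest modulus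
      |α - (-1.488)| < 0.0005 ∧
      chromaticF (α : ℂ) = 0 ∧
      deriv (chromaticF : ℂ → ℂ) (α : ℂ) ≠ 0 ∧
      (∀ z : ℂ, chromaticF z = 0 → z ≠ (α : ℂ) → |α| < ‖z‖) ∧
      -- the constants
      chromaticF (α / 2) ≠ 0 ∧
      C = -1 / (α * chromaticF (α / 2)) ∧
      K = -(1 - chromaticF (2 * α)) / (α * chromaticF (α / 2)) ∧
      -- asymptotics of the two counting sequences
      (fun n : ℕ => (acyclicCount n : ℝ)) ~[atTop]
        (fun n : ℕ => C * 2 ^ n.choose 2 * (n.factorial : ℝ) * (-1 / α) ^ n) ∧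
      (fun n : ℕ => (evenAcyclicCount n : ℝ)) ~[atTop]
        (fun n : ℕ => K * 2 ^ n.choose 2 * (n.factorial : ℝ) * (-1 / (2 * α)) ^ n) ∧
      -- the ratio
      (fun n : ℕ => (evenAcyclicCount n : ℝ) / (acyclicCount n : ℝ)) ~[atTop]
        (fun n : ℕ => K / (C * 2 ^ n)) ∧
      |K / C - 1.262| < 0.0005 := by
  obtain ⟨α, h1, h2, h0⟩ := exists_chromaticF_eq_zero
  have hα0 : α ≠ 0 := by linarith
  have hα : |α| ≤ 3 := by rw [abs_le]; constructor <;> linarith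
  have hlt := tsum_norm_chromaticPartialSum_succ_lt h1 h2 h0
  have hhalf : chromaticF (α / 2) ≠ 0 := by
    have h := tsum_mul_pow_ne_zero chromaticPartialSum_zero
      (summable_norm_chromaticPartialSum_succ hα h0) hlt (w := 1) (by simp)
    simp only [one_pow, mul_one, ← Complex.ofReal_tsum, tsum_chromaticPartialSum hα h0] at h
    intro h'
    simp [h'] at h
  have hK := abs_chromaticF_two_mul_sub_lt h1 h2
  have hK0 : 1 - chromaticF (2 * α) ≠ 0 := by
    have := (abs_lt.1 hK).1
    intro h
    rw [h] at this
    norm_num at this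
  have hC' : -1 / (α * chromaticF (α / 2)) ≠ 0 :=
    div_ne_zero (by norm_num) (mul_ne_zero hα0 hhalf)
  have hK' : -(1 - chromaticF (2 * α)) / (α * chromaticF (α / 2)) ≠ 0 :=
    div_ne_zero (neg_ne_zero.2 hK0) (mul_ne_zero hα0 hhalf)
  have hR := isEquivalent_of_tendsto_normalized hα0 hC' (tendsto_acyclicCount hα h0 hlt)
  have hO := isEquivalent_of_tendsto_normalized (mul_ne_zero two_ne_zero hα0) hK'
    (tendsto_evenAcyclicCount hα h0 hlt)
  refine ⟨α, _, _, ?_, ?_, ?_, fun z hz hne => ?_, hhalf, rfl, rfl, hR, hO, ?_, ?_⟩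
  · rw [abs_lt]
    constructor <;> linarith
  · rw [← ofReal_chromaticF, h0, Complex.ofReal_zero]
  · rw [(hasDerivAt_chromaticF (α : ℂ)).deriv]
    have h : ((α / 2 : ℝ) : ℂ) = (α : ℂ) / 2 := by push_cast; rfl
    rw [← h, ← ofReal_chromaticF]
    exact Complex.ofReal_ne_zero.2 hhalf
  · by_contra hle
    exact chromaticF_ne_zero_of_norm_le hα0 hα h0 hlt (not_lt.1 hle) hne hz
  · refine (hO.div hR).congr_right (.of_forall fun n => ?_)
    have h3 : (n.factorial : ℝ) ≠ 0 := by positivity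
    have h4 : (-1 / α) ^ n ≠ 0 := pow_ne_zero _ (div_ne_zero (by norm_num) hα0)
    have h5 : (-1 / (2 * α)) ^ n = (-1 / α) ^ n / 2 ^ n := by
      rw [← div_pow, div_div, mul_comm]
    rw [Pi.div_apply, h5]
    generalize -1 / (α * chromaticF (α / 2)) = C at hC' ⊢
    generalize (-1 / α) ^ n = E at h4 ⊢
    field_simp
  · have h : -(1 - chromaticF (2 * α)) / (α * chromaticF (α / 2)) /
        (-1 / (α * chromaticF (α / 2))) = 1 - chromaticF (2 * α) := by
      field_simp
    rwa [h]
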